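/- For integers $p, k$ with $k \ge 2$ and $p \ge 2k$, let $G = J(p,k)$ be the Johnson graph: its vertices are the $k$-element subsets of a $p$-element set, two of them being adjacent when their intersection has exactly $k-1$ elements. Let $m$ be the number of edges of $G$, let $\omega$ be its clique number, let $\mu_1 \ge \mu_2 \ge \cdots \ge \mu_n$, $n = \binom{p}{k}$, be the eigenvalues of the adjacency matrix of $G$, listed with multiplicity, and let $n^+$ be the number of positive ones, counted with multiplicity. Then $\omega = p-k+1$ and \[ \mu_1^2 + \mu_2^2 + \cdots + \mu_\ell^2 \le \frac{2m(\omega-1)}{\omega}, \qquad \text{where } \ell = \min(n^+, \omega). \] -/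

import Mathlib

/-- The Johnson graph `J(p, k)`: its vertices are the `k`-element subsets of a `p`-element set, and
two (distinct) vertices are adjacent when their intersection has exactly `k - 1` elements.
Writing this as `card (s ∩ t) + 1 = k` avoids truncated subtraction and forces `s ≠ t`. -/
def johnsonGraph (p k : ℕ) : SimpleGraph {s : Finset (Fin p) // s.card = k} where
  Adj s t := (s.1 ∩ t.1).card + 1 = k
  symm := ⟨fun s t h => by rw [Finset.inter_comm]; exact h⟩
  loopless := ⟨fun s h => by
    have h1 := s.2
    rw [Finset.inter_self] at h
    omega⟩

instance johnsonGraph.instDecidableRelAdj (p k : ℕ) : DecidableRel (johnsonGraph p k).Adj :=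
  fun s t => inferInstanceAs (Decidable ((s.1 ∩ t.1).card + 1 = k))

section GraphSpectrum

variable {V : Type*} [Fintype V] [DecidableEq V]

/-- The eigenvalues `μ 0 ≥ μ 1 ≥ ⋯` of the adjacency matrix of `G`, listed with multiplicity in
decreasing order. -/
noncomputable def graphEigenvalue (G : SimpleGraph V) [DecidableRel G.Adj] :
    Fin (Fintype.card V) → ℝ :=
  (G.isHermitian_adjMatrix (R := ℝ)).eigenvalues₀

/-- `n⁺(G)`: the number of positive eigenvalues of `G`, counted with multiplicity. -/
noncomputable def numPosEigenvalues (G : SimpleGraph V) [DecidableRel G.Adj] : ℕ :=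
  Nat.card {i : Fin (Fintype.card V) // 0 < graphEigenvalue G i}

/-- `μ₁² + ⋯ + μ_ℓ²`: the sum of the squares of the `ℓ` largest eigenvalues of `G`. -/
noncomputable def sumSqLargestEigenvalues (G : SimpleGraph V) [DecidableRel G.Adj] (l : ℕ) : ℝ :=
  ∑ i : Fin (Fintype.card V) with i.val < l, (graphEigenvalue G i) ^ 2

end GraphSpectrum

/-!
Write `q = p - k`, so that `2 ≤ k ≤ q`. The Johnson graph `J(p, k)` is regular of degree `k * q`,
its clique number is `q + 1`, and all its eigenvalues but the first are at most `c = k * q - k - q`,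
which is nonnegative. Hence the squares of at most `q + 1` positive eigenvalues add up to at most
`(k * q) ^ 2 + q * c ^ 2`, and the claim reduces to an inequality between this number and
`choose p k * k * q ^ 2 / (q + 1)`, proved in `two_eigenvalue_sq_le`.

The bound `c` needs none of the exact spectrum. Let `U` be the inclusion operator from functions on
`(k - 1)`-sets to functions on `k`-sets. Then `U Uᵀ = A_k + k` and `Uᵀ U = A_(k-1) + (p - k + 1)`,
where `A_j` is the adjacency operator of `J(p, j)`; so `Uᵀ` carries zero-sum eigenfunctions for
eigenvalues other than `-k` to zero-sum eigenfunctions one level down, and induction on `k` bounds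
the eigenvalues (`exchangeSum_eigenvalue_le`). In a regular graph at most one eigenvalue, the
degree, can exceed the bound on zero-sum vectors (`graphEigenvalue_le_of_pos`).

For the clique number (`cliqueNum_johnsonGraph`), either all members of a clique contain a common
`(k - 1)`-set, which allows `q + 1` of them, or all lie in a common `(k + 1)`-set, which allows
`k + 1 ≤ q + 1`.
-/

/-! ### The exchange operator and its eigenvalues -/

section Exchange

variable {α : Type*} [Fintype α] [DecidableEq α]

/-- The adjacency operator of the Johnson graphs, acting on functions of all finite sets: the sum
of `f` over the sets obtained from `s` by replacing one element of `s` by one outside `s`. -/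
def exchangeSum (f : Finset α → ℝ) (s : Finset α) : ℝ :=
  ∑ x ∈ s, ∑ y ∈ sᶜ, f (insert y (s.erase x))

/-- The sum of `f` over the sets that cover `t`, that is, have exactly one more element. -/
def coverSum (f : Finset α → ℝ) (t : Finset α) : ℝ :=
  ∑ y ∈ tᶜ, f (insert y t)

/-- On `k`-sets, going down and then up is `A + k`. -/
lemma sum_coverSum_erase (f : Finset α → ℝ) (s : Finset α) :
    ∑ x ∈ s, coverSum f (s.erase x) = s.card * f s + exchangeSum f s := by
  have h : ∀ x ∈ s, coverSum f (s.erase x) = f s + ∑ y ∈ sᶜ, f (insert y (s.erase x)) := by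
    intro x hx
    rw [coverSum, Finset.compl_erase, Finset.sum_insert (by simpa using hx),
      Finset.insert_erase hx]
  rw [Finset.sum_congr rfl h, Finset.sum_add_distrib, Finset.sum_const, nsmul_eq_mul, exchangeSum]

/-- On `k`-sets of a `p`-set, going up and then down is `A + (p - k)`. -/
lemma coverSum_sum_erase (g : Finset α → ℝ) (t : Finset α) :
    coverSum (fun s => ∑ x ∈ s, g (s.erase x)) t = tᶜ.card * g t + exchangeSum g t := by
  have h : ∀ y ∈ tᶜ, ∑ x ∈ insert y t, g ((insert y t).erase x) =
      g t + ∑ x ∈ t, g (insert y (t.erase x)) := by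
    intro y hy
    have hy' : y ∉ t := by simpa using hy
    rw [Finset.sum_insert hy', Finset.erase_insert hy']
    congr 1
    refine Finset.sum_congr rfl fun x hx => ?_
    rw [Finset.erase_insert_of_ne]
    rintro rfl
    exact hy' hx
  rw [coverSum, Finset.sum_congr rfl h, Finset.sum_add_distrib, Finset.sum_const, nsmul_eq_mul,
    exchangeSum, Finset.sum_comm]

lemma sum_powersetCard_coverSum (f : Finset α → ℝ) (k : ℕ) :
    ∑ t ∈ Finset.powersetCard k Finset.univ, coverSum f t =
      (k + 1) * ∑ s ∈ Finset.powersetCard (k + 1) Finset.univ, f s := by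
  have h : ∀ s ∈ Finset.powersetCard (k + 1) (Finset.univ : Finset α),
      ((k : ℝ) + 1) * f s = ∑ _x ∈ s, f s := by
    intro s hs
    rw [Finset.sum_const, (Finset.mem_powersetCard.1 hs).2, nsmul_eq_mul]
    push_cast
    ring
  rw [Finset.mul_sum, Finset.sum_congr rfl h]
  simp only [coverSum]
  rw [Finset.sum_sigma', Finset.sum_sigma']
  refine Finset.sum_bij' (fun a _ => ⟨insert a.2 a.1, a.2⟩) (fun a _ => ⟨a.1.erase a.2, a.2⟩)
    ?_ ?_ ?_ ?_ ?_
  · rintro ⟨t, y⟩ h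
    simp only [Finset.mem_sigma, Finset.mem_powersetCard, Finset.mem_compl] at h ⊢
    simp [h.1.2, h.2]
  · rintro ⟨s, x⟩ h
    simp only [Finset.mem_sigma, Finset.mem_powersetCard, Finset.mem_compl] at h ⊢
    simp [h.1.2, h.2]
  · rintro ⟨t, y⟩ h
    simp only [Finset.mem_sigma, Finset.mem_compl] at h
    simp [h.2]
  · rintro ⟨s, x⟩ h
    simp only [Finset.mem_sigma] at h
    simp [h.2]
  · intro _ _
    rfl

/-- An eigenfunction of the Johnson graph `J(p, k + 1)` with zero sum has eigenvalue at most
`k (p - k - 2) - 1`. If its image under `coverSum` vanishes, the eigenvalue is `-(k + 1)`;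
otherwise that image is an eigenfunction of `J(p, k)` with zero sum, and the eigenvalue has
dropped by `p - 2 k - 1`. -/
theorem exchangeSum_eigenvalue_le (k : ℕ) (hk : k + 1 ≤ Fintype.card α) (f : Finset α → ℝ) (μ : ℝ)
    (hf : ∀ s : Finset α, s.card = k + 1 → exchangeSum f s = μ * f s)
    (hsum : ∑ s ∈ Finset.powersetCard (k + 1) Finset.univ, f s = 0)
    (hne : ∃ s : Finset α, s.card = k + 1 ∧ f s ≠ 0) :
    μ ≤ k * ((Fintype.card α : ℝ) - k - 2) - 1 := by
  induction k generalizing f μ with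
  | zero =>
    obtain ⟨s, hs, hfs⟩ := hne
    have h0 : coverSum f ∅ = 0 := by
      have := sum_powersetCard_coverSum f 0
      rw [hsum] at this
      simpa using this
    have h1 := sum_coverSum_erase f s
    have h2 : ∀ x ∈ s, coverSum f (s.erase x) = 0 := by
      intro x hx
      have : s.erase x = ∅ := by
        rw [← Finset.card_eq_zero, Finset.card_erase_of_mem hx, hs]
      rw [this, h0]
    rw [Finset.sum_eq_zero h2, hf s hs, hs] at h1
    have h3 : (μ + 1) * f s = 0 := by push_cast at h1; linarith
    have h4 := (mul_eq_zero.1 h3).resolve_right hfs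
    push_cast
    linarith
  | succ k ih =>
    have hk' : ((k : ℝ) + 1 + 1) ≤ Fintype.card α := by exact_mod_cast hk
    have hdown : ∀ s : Finset α, s.card = k + 1 + 1 →
        ∑ x ∈ s, coverSum f (s.erase x) = (μ + k + 2) * f s := by
      intro s hs
      rw [sum_coverSum_erase, hf s hs, hs]
      push_cast
      ring
    by_cases hg : ∃ t : Finset α, t.card = k + 1 ∧ coverSum f t ≠ 0
    · have heig : ∀ t : Finset α, t.card = k + 1 → exchangeSum (coverSum f) t =
          (μ + 2 * k + 3 - Fintype.card α) * coverSum f t := by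
        intro t ht
        have h1 := coverSum_sum_erase (coverSum f) t
        have h2 : coverSum (fun s => ∑ x ∈ s, coverSum f (s.erase x)) t =
            (μ + k + 2) * coverSum f t := by
          conv_rhs => rw [coverSum, Finset.mul_sum]
          refine Finset.sum_congr rfl fun y hy => hdown _ ?_
          rw [Finset.card_insert_of_notMem (by simpa using hy), ht]
        have h3 : (tᶜ.card : ℝ) = Fintype.card α - (k + 1) := by
          rw [Finset.card_compl, ht, Nat.cast_sub (by omega)]
          push_cast
          ring
        rw [h2, h3] at h1
        linarith
      have hle := ih (by omega) (coverSum f) _ heig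
        (by rw [sum_powersetCard_coverSum, hsum, mul_zero]) hg
      push_cast
      linarith
    · push Not at hg
      obtain ⟨s, hs, hfs⟩ := hne
      have h1 := hdown s hs
      rw [Finset.sum_eq_zero fun x hx => hg _ (by
        rw [Finset.card_erase_of_mem hx, hs]; rfl)] at h1
      have h2 := (mul_eq_zero.1 h1.symm).resolve_right hfs
      have h3 : 0 ≤ ((k : ℝ) + 1) * (Fintype.card α - (k + 1 + 1)) :=
        mul_nonneg (by positivity) (by linarith)
      push_cast
      linarith

end Exchange

/-! ### The numerical inequality -/

section Arithmetic

lemma choose_three_le_choose {n k : ℕ} (hk : 3 ≤ k) (hn : 2 * k ≤ n) :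
    n.choose 3 ≤ n.choose k := by
  induction k, hk using Nat.le_induction with
  | base => exact le_rfl
  | succ k _ ih => exact (ih (by omega)).trans (Nat.choose_le_succ_of_lt_half_left (by omega))

/-- The numerical inequality for the squares of the two largest eigenvalues `k * q` and
`k * q - k - q` of `J(q + k, k)`. For `k ≥ 3` the cubic bound `choose (q + k) 3` of the number of
vertices suffices. -/
lemma two_eigenvalue_sq_le (q k : ℕ) (hk : 2 ≤ k) (hq : k ≤ q) :
    ((q : ℝ) + 1) * (k ^ 2 * q + (k * q - k - q) ^ 2) ≤ k * q * ((q + k).choose k : ℝ) := by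
  obtain rfl | hk3 : k = 2 ∨ 3 ≤ k := by omega
  · have hq' : (2 : ℝ) ≤ q := by exact_mod_cast hq
    have hc : ((q + 2).choose 2 : ℝ) = (q + 2) * (q + 1) / 2 := by
      rw [Nat.cast_choose_two]
      push_cast
      ring
    rw [hc]
    push_cast
    nlinarith [mul_nonneg (by linarith : (0 : ℝ) ≤ q + 1) (by linarith : (0 : ℝ) ≤ q - 2)]
  · have hle : ((q + k).choose 3 : ℝ) ≤ ((q + k).choose k : ℝ) := by
      exact_mod_cast choose_three_le_choose hk3 (by omega)
    have hc : ((q + k).choose 3 : ℝ) = (q + k) * (q + k - 1) * (q + k - 2) / 6 := by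
      rw [Nat.cast_choose_eq_ascPochhammer_div]
      have : q + k - (3 - 1) = q + k - 2 := rfl
      rw [this, Nat.cast_sub (by omega)]
      simp [ascPochhammer_succ_right, Nat.factorial]
      ring
    have hpoly : 6 * (((q : ℝ) + 1) * (k ^ 2 * q + (k * q - k - q) ^ 2)) ≤
        k * q * ((q + k) * (q + k - 1) * (q + k - 2)) := by
      obtain ⟨b, rfl⟩ := Nat.exists_eq_add_of_le hk3
      obtain ⟨a, rfl⟩ := Nat.exists_eq_add_of_le hq
      push_cast
      rw [← sub_nonneg]
      -- in terms of `a` and `b` all coefficients of the difference are nonnegative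
      ring_nf
      positivity
    calc _ ≤ (k : ℝ) * q * ((q + k).choose 3 : ℝ) := by rw [hc]; linarith
      _ ≤ _ := by gcongr

end Arithmetic

/-! ### The clique number of the Johnson graph -/

section Clique

variable {p k : ℕ}

lemma johnsonGraph_adj_of_sunflower {r : Finset (Fin p)} (hr : r.card + 1 = k) {x y : Fin p}
    (hxy : x ≠ y) : (insert x r ∩ insert y r).card + 1 = k := by
  have : insert x r ∩ insert y r = r := by
    ext z
    simp only [Finset.mem_inter, Finset.mem_insert]
    grind
  rw [this, hr]

lemma le_cliqueNum_johnsonGraph (hk : 1 ≤ k) (hp : k ≤ p) :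
    p - k + 1 ≤ (johnsonGraph p k).cliqueNum := by
  classical
  obtain ⟨r, -, hr⟩ := Finset.exists_subset_card_eq
    (s := (Finset.univ : Finset (Fin p))) (n := k - 1) (by simp; omega)
  -- the clique of all `k`-sets that contain `r`
  let φ : {x // x ∈ rᶜ} → {s : Finset (Fin p) // s.card = k} := fun x =>
    ⟨insert x.1 r, by rw [Finset.card_insert_of_notMem (Finset.mem_compl.1 x.2), hr]; omega⟩
  have hφ : Function.Injective φ := by
    rintro ⟨x, hx⟩ ⟨y, hy⟩ h
    have h1 : insert x r = insert y r := congrArg Subtype.val h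
    have h2 : x ∈ insert y r := h1 ▸ Finset.mem_insert_self x r
    have h3 : x ∉ r := by simpa using hx
    exact Subtype.ext ((Finset.mem_insert.1 h2).resolve_right h3)
  have hclique : (johnsonGraph p k).IsClique (Finset.univ.image φ : Finset _) := by
    intro s hs t ht hst
    simp only [Finset.coe_image, Finset.coe_univ, Set.image_univ, Set.mem_range] at hs ht
    obtain ⟨x, rfl⟩ := hs
    obtain ⟨y, rfl⟩ := ht
    refine johnsonGraph_adj_of_sunflower (by omega) ?_
    intro h
    exact hst (congrArg φ (Subtype.ext h))
  have := hclique.card_le_cliqueNum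
  rw [Finset.card_image_of_injective _ hφ, Finset.card_univ, Fintype.card_coe, Finset.card_compl,
    hr, Fintype.card_fin] at this
  omega

/-- A neighbour of two adjacent sets `s` and `t` either contains `s ∩ t` or is contained in
`s ∪ t`. -/
lemma inter_subset_or_subset_union {s t u : Finset (Fin p)} (hu : u.card = k)
    (hst : (s ∩ t).card + 1 = k) (hus : (u ∩ s).card + 1 = k)
    (hut : (u ∩ t).card + 1 = k) : s ∩ t ⊆ u ∨ u ⊆ s ∪ t := by
  by_contra! h
  obtain ⟨h1, h2⟩ := h
  obtain ⟨x, hx, hxu⟩ := Finset.not_subset.1 h1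
  obtain ⟨y, hy, hyst⟩ := Finset.not_subset.1 h2
  rw [Finset.mem_inter] at hx
  rw [Finset.mem_union, not_or] at hyst
  -- `u` loses exactly `y` against both `s` and `t`, and `s` loses exactly `x` against `u`
  have e1 : u ∩ s = u.erase y := Finset.eq_of_subset_of_card_le
    (fun z hz => by
      rw [Finset.mem_inter] at hz
      exact Finset.mem_erase.2 ⟨fun h => hyst.1 (h ▸ hz.2), hz.1⟩)
    (by rw [Finset.card_erase_of_mem hy]; omega)
  have e2 : u ∩ t = u.erase y := Finset.eq_of_subset_of_card_le
    (fun z hz => by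
      rw [Finset.mem_inter] at hz
      exact Finset.mem_erase.2 ⟨fun h => hyst.2 (h ▸ hz.2), hz.1⟩)
    (by rw [Finset.card_erase_of_mem hy]; omega)
  have hsub : insert x (u.erase y) ⊆ s ∩ t := by
    intro z hz
    rcases Finset.mem_insert.1 hz with rfl | hz
    · exact Finset.mem_inter.2 hx
    · exact Finset.mem_inter.2
        ⟨(Finset.mem_inter.1 (e1 ▸ hz)).2, (Finset.mem_inter.1 (e2 ▸ hz)).2⟩
  have hcard := Finset.card_le_card hsub
  rw [Finset.card_insert_of_notMem (fun h => hxu (Finset.mem_erase.1 h).2),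
    Finset.card_erase_of_mem hy] at hcard
  omega

lemma card_le_of_forall_subset {r : Finset (Fin p)} (hr : r.card + 1 = k)
    {C : Finset {s : Finset (Fin p) // s.card = k}} (hC : ∀ u ∈ C, r ⊆ u.1) :
    C.card ≤ p - k + 1 := by
  have h : C.map (Function.Embedding.subtype _) ⊆ rᶜ.image fun x => insert x r := by
    intro u hu
    simp only [Finset.mem_map, Function.Embedding.subtype_apply] at hu
    obtain ⟨v, hv, rfl⟩ := hu
    obtain ⟨x, hx, h⟩ := (Finset.covBy_iff_exists_insert.1
      (Finset.covBy_iff_card_sdiff_eq_one.2 ⟨hC v hv, by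
        rw [Finset.card_sdiff_of_subset (hC v hv), v.2]; omega⟩))
    exact Finset.mem_image.2 ⟨x, by simpa using hx, h⟩
  have h1 := (Finset.card_le_card h).trans Finset.card_image_le
  have h2 := Finset.card_le_univ r
  rw [Finset.card_map, Finset.card_compl, Fintype.card_fin] at h1
  rw [Fintype.card_fin] at h2
  omega

lemma card_le_of_forall_superset {w : Finset (Fin p)} (hw : w.card = k + 1)
    {C : Finset {s : Finset (Fin p) // s.card = k}} (hC : ∀ u ∈ C, u.1 ⊆ w) :
    C.card ≤ k + 1 := by
  have h : C.map (Function.Embedding.subtype _) ⊆ w.powersetCard k := by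
    intro u hu
    simp only [Finset.mem_map, Function.Embedding.subtype_apply] at hu
    obtain ⟨v, hv, rfl⟩ := hu
    exact Finset.mem_powersetCard.2 ⟨hC v hv, v.2⟩
  have h1 := Finset.card_le_card h
  rwa [Finset.card_map, Finset.card_powersetCard, hw, Nat.choose_succ_self_right] at h1

/-- All members of a clique contain a common `(k - 1)`-set, or all lie in a common
`(k + 1)`-set. -/
lemma card_le_of_isClique_johnsonGraph (hp : 2 * k ≤ p)
    {C : Finset {s : Finset (Fin p) // s.card = k}} (hC : (johnsonGraph p k).IsClique C) :
    C.card ≤ p - k + 1 := by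
  have hadj : ∀ u ∈ C, ∀ v ∈ C, u ≠ v → (u.1 ∩ v.1).card + 1 = k :=
    fun u hu v hv huv => hC hu hv huv
  rcases le_or_gt C.card 1 with hle | hgt
  · omega
  obtain ⟨s, hs, t, ht, hst⟩ := Finset.one_lt_card.1 hgt
  have hcard := hadj s hs t ht hst
  have hunion : (s.1 ∪ t.1).card = k + 1 := by
    have := Finset.card_union_add_card_inter s.1 t.1
    rw [s.2, t.2] at this
    omega
  by_cases hsub : ∀ u ∈ C, s.1 ∩ t.1 ⊆ u.1
  · exact card_le_of_forall_subset hcard hsub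
  push Not at hsub
  obtain ⟨u, hu, hur⟩ := hsub
  have hus : u ≠ s := by rintro rfl; exact hur Finset.inter_subset_left
  have hut : u ≠ t := by rintro rfl; exact hur Finset.inter_subset_right
  have huw : u.1 ⊆ s.1 ∪ t.1 := (inter_subset_or_subset_union u.2 hcard
    (hadj u hu s hs hus) (hadj u hu t ht hut)).resolve_left hur
  refine (card_le_of_forall_superset hunion fun v hv => ?_).trans (by omega)
  by_cases hvs : v = s
  · exact hvs ▸ Finset.subset_union_left
  by_cases hvt : v = t
  · exact hvt ▸ Finset.subset_union_right
  by_cases hvu : v = u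
  · exact hvu ▸ huw
  by_contra hvw
  have hrv := (inter_subset_or_subset_union v.2 hcard
    (hadj v hv s hs hvs) (hadj v hv t ht hvt)).resolve_right hvw
  -- the element of `v` outside `s ∪ t` is the only one outside `s ∩ t`, so `v ∩ u` misses it and
  -- is a proper subset of `s ∩ t`
  obtain ⟨c, hcv, hcw⟩ := Finset.not_subset.1 hvw
  have hcr : c ∉ s.1 ∩ t.1 := fun h => hcw (Finset.mem_union_left _ (Finset.mem_inter.1 h).1)
  have hv : insert c (s.1 ∩ t.1) = v.1 := Finset.eq_of_subset_of_card_le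
    (Finset.insert_subset hcv hrv) (by rw [Finset.card_insert_of_notMem hcr, v.2, hcard])
  have hlt : v.1 ∩ u.1 ⊂ s.1 ∩ t.1 := by
    refine (Finset.ssubset_iff_subset_ne).2 ⟨fun z hz => ?_, fun h => ?_⟩
    · rw [Finset.mem_inter, ← hv, Finset.mem_insert] at hz
      exact hz.1.resolve_left fun h => hcw (huw (h ▸ hz.2))
    · exact hur (h ▸ Finset.inter_subset_right)
  have h1 := Finset.card_lt_card hlt
  have h2 := hadj v ‹v ∈ C› u hu hvu
  omega

theorem cliqueNum_johnsonGraph (hk : 1 ≤ k) (hp : 2 * k ≤ p) :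
    (johnsonGraph p k).cliqueNum = p - k + 1 := by
  refine le_antisymm ?_ (le_cliqueNum_johnsonGraph hk (by omega))
  obtain ⟨C, hC⟩ := (johnsonGraph p k).exists_isNClique_cliqueNum
  rw [← hC.card_eq]
  exact card_le_of_isClique_johnsonGraph hp hC.isClique

end Clique

/-! ### Eigenvalues of regular graphs -/

section Spectrum

open scoped Matrix

variable {V : Type*} [Fintype V] {G : SimpleGraph V} [DecidableRel G.Adj]

/-- An eigenvector of a regular graph that is not orthogonal to the constant vector has the degree
as its eigenvalue. -/
lemma eq_degree_of_sum_ne_zero {d : ℕ} (hG : G.IsRegularOfDegree d) {μ : ℝ} {x : V → ℝ}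
    (hx : G.adjMatrix ℝ *ᵥ x = μ • x) (hsum : ∑ s, x s ≠ 0) : μ = d := by
  have h : (fun _ => (1 : ℝ)) ⬝ᵥ (G.adjMatrix ℝ *ᵥ x) = d * ∑ s, x s := by
    rw [Matrix.dotProduct_mulVec, ← Matrix.mulVec_transpose, SimpleGraph.transpose_adjMatrix]
    have h1 : G.adjMatrix ℝ *ᵥ (fun _ => (1 : ℝ)) = fun _ => (d : ℝ) := by
      ext v
      have := SimpleGraph.adjMatrix_mulVec_const_apply_of_regular (a := (1 : ℝ)) (v := v) hG
      simpa [Function.const_def] using this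
    rw [h1, dotProduct, Finset.mul_sum]
  rw [hx, dotProduct_smul, smul_eq_mul] at h
  simp only [dotProduct, one_mul] at h
  exact mul_right_cancel₀ hsum h

variable [DecidableEq V]

lemma antitone_graphEigenvalue : Antitone (graphEigenvalue G) :=
  Matrix.IsHermitian.eigenvalues₀_antitone _

lemma exists_orthonormal_eigenvectors (G : SimpleGraph V) [DecidableRel G.Adj] :
    ∃ v : Fin (Fintype.card V) → V → ℝ,
      (∀ i, G.adjMatrix ℝ *ᵥ v i = graphEigenvalue G i • v i) ∧
      ∀ i j, v i ⬝ᵥ v j = if i = j then 1 else 0 := by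
  set hA := G.isHermitian_adjMatrix (R := ℝ)
  let e : Fin (Fintype.card V) ≃ V := Fintype.equivOfCardEq (Fintype.card_fin _)
  refine ⟨fun i => hA.eigenvectorBasis (e i), fun i => ?_, fun i j => ?_⟩
  · have h := hA.mulVec_eigenvectorBasis (e i)
    have h2 : hA.eigenvalues (e i) = graphEigenvalue G i := by
      simp [Matrix.IsHermitian.eigenvalues, graphEigenvalue, e]
    rwa [h2] at h
  · have h := orthonormal_iff_ite.1 hA.eigenvectorBasis.orthonormal (e j) (e i)
    rw [EuclideanSpace.inner_eq_star_dotProduct] at h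
    simpa [eq_comm] using h

variable {d : ℕ} {c : ℝ}

lemma graphEigenvalue_le_degree (hG : G.IsRegularOfDegree d) (hcd : c ≤ d)
    (hc : ∀ (μ : ℝ) (x : V → ℝ), G.adjMatrix ℝ *ᵥ x = μ • x → ∑ s, x s = 0 → x ≠ 0 → μ ≤ c)
    (i : Fin (Fintype.card V)) : graphEigenvalue G i ≤ d := by
  obtain ⟨v, hv, ho⟩ := exists_orthonormal_eigenvectors G
  by_cases hsum : ∑ s, v i s = 0
  · refine (hc _ _ (hv i) hsum fun h0 => ?_).trans hcd
    have := ho i i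
    simp [h0] at this
  · exact (eq_degree_of_sum_ne_zero hG (hv i) hsum).le

/-- If `c` bounds the eigenvalues of a regular graph on the zero-sum vectors, then it bounds all
eigenvalues but the first: a second eigenvector with a larger eigenvalue would, like the first, have
the degree as its eigenvalue, and a combination of the two has zero sum. -/
lemma graphEigenvalue_le_of_pos (hG : G.IsRegularOfDegree d)
    (hc : ∀ (μ : ℝ) (x : V → ℝ), G.adjMatrix ℝ *ᵥ x = μ • x → ∑ s, x s = 0 → x ≠ 0 → μ ≤ c)
    (i : Fin (Fintype.card V)) (hi : 0 < i.val) : graphEigenvalue G i ≤ c := by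
  by_contra! hlt
  obtain ⟨v, hv, ho⟩ := exists_orthonormal_eigenvectors G
  let j : Fin (Fintype.card V) := ⟨0, by omega⟩
  have hij : i ≠ j := fun h => hi.ne' (congrArg Fin.val h)
  have hji : c < graphEigenvalue G j := hlt.trans_le (antitone_graphEigenvalue (Nat.zero_le _))
  have hne : ∀ l, c < graphEigenvalue G l → ∑ s, v l s ≠ 0 := by
    intro l hl hsum
    refine hl.not_ge (hc _ _ (hv l) hsum fun h0 => ?_)
    have := ho l l
    simp [h0] at this
  have hμi := eq_degree_of_sum_ne_zero hG (hv i) (hne i hlt)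
  have hμj := eq_degree_of_sum_ne_zero hG (hv j) (hne j hji)
  have hle := hc d ((∑ s, v j s) • v i - (∑ s, v i s) • v j)
    (by
      rw [Matrix.mulVec_sub, Matrix.mulVec_smul, Matrix.mulVec_smul, hv, hv, hμi, hμj, smul_sub,
        smul_comm (d : ℝ), smul_comm (d : ℝ)])
    (by
      simp only [Pi.sub_apply, Pi.smul_apply, smul_eq_mul, Finset.sum_sub_distrib,
        ← Finset.mul_sum]
      ring)
    (fun h0 => by
      have h1 := congrArg (v i ⬝ᵥ ·) h0
      simp only [dotProduct_sub, dotProduct_smul, ho, hij, if_true, if_false, smul_eq_mul,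
        dotProduct_zero, mul_one, mul_zero, sub_zero] at h1
      exact hne j hji h1)
  rw [hμi] at hlt
  exact hlt.not_ge hle

lemma graphEigenvalue_pos_of_lt (i : Fin (Fintype.card V)) (hi : i.val < numPosEigenvalues G) :
    0 < graphEigenvalue G i := by
  by_contra! hle
  have hsub : (Finset.univ.filter fun j => 0 < graphEigenvalue G j) ⊆ Finset.Iio i := by
    intro j hj
    rw [Finset.mem_Iio]
    by_contra! hij
    exact (Finset.mem_filter.1 hj).2.not_ge ((antitone_graphEigenvalue hij).trans hle)
  have h := Finset.card_le_card hsub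
  rw [Fin.card_Iio, ← Fintype.card_subtype, ← Nat.card_eq_fintype_card] at h
  exact h.not_gt hi

/-- The largest of at most `w` positive eigenvalues is at most the degree, the others at
most `c`. -/
lemma sumSqLargestEigenvalues_le (hG : G.IsRegularOfDegree d) (hc0 : 0 ≤ c) (hcd : c ≤ d)
    (hc : ∀ (μ : ℝ) (x : V → ℝ), G.adjMatrix ℝ *ᵥ x = μ • x → ∑ s, x s = 0 → x ≠ 0 → μ ≤ c)
    (w : ℕ) :
    sumSqLargestEigenvalues G (min (numPosEigenvalues G) (w + 1)) ≤ d ^ 2 + w * c ^ 2 := by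
  have hdc : (0 : ℝ) ≤ d ^ 2 - c ^ 2 := by nlinarith
  set S := Finset.univ.filter
    fun i : Fin (Fintype.card V) => i.val < min (numPosEigenvalues G) (w + 1)
  have hterm : ∀ i ∈ S, graphEigenvalue G i ^ 2 ≤
      c ^ 2 + if i.val = 0 then (d : ℝ) ^ 2 - c ^ 2 else 0 := by
    intro i hi
    have hpos := graphEigenvalue_pos_of_lt i ((Finset.mem_filter.1 hi).2.trans_le (min_le_left _ _))
    split_ifs with h0
    · have := pow_le_pow_left₀ hpos.le (graphEigenvalue_le_degree hG hcd hc i) 2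
      linarith
    · have := pow_le_pow_left₀ hpos.le (graphEigenvalue_le_of_pos hG hc i (by omega)) 2
      linarith
  have hcard : S.card ≤ w + 1 := by
    have h : S.card ≤ (Finset.range (w + 1)).card :=
      Finset.card_le_card_of_injOn Fin.val
        (fun i hi => by
          have := (Finset.mem_filter.1 hi).2
          simp only [Finset.coe_range, Set.mem_Iio]
          omega)
        (Fin.val_injective.injOn)
    simpa using h
  have hone : ∑ i ∈ S, (if i.val = 0 then (d : ℝ) ^ 2 - c ^ 2 else 0) ≤ d ^ 2 - c ^ 2 := by
    rw [← Finset.sum_filter, Finset.sum_const, nsmul_eq_mul]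
    have h1 : (S.filter fun i => i.val = 0).card ≤ 1 := by
      rw [Finset.card_le_one]
      intro a ha b hb
      exact Fin.ext ((Finset.mem_filter.1 ha).2.trans (Finset.mem_filter.1 hb).2.symm)
    exact mul_le_of_le_one_left hdc (by exact_mod_cast h1)
  have hcard' : (S.card : ℝ) * c ^ 2 ≤ (w + 1) * c ^ 2 := by
    have : (S.card : ℝ) ≤ w + 1 := by exact_mod_cast hcard
    gcongr
  calc sumSqLargestEigenvalues G (min (numPosEigenvalues G) (w + 1))
      ≤ ∑ i ∈ S, (c ^ 2 + if i.val = 0 then (d : ℝ) ^ 2 - c ^ 2 else 0) :=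
        Finset.sum_le_sum hterm
    _ ≤ d ^ 2 + w * c ^ 2 := by
        rw [Finset.sum_add_distrib, Finset.sum_const, nsmul_eq_mul]
        linarith

end Spectrum

/-! ### Degree, size and eigenvalues of the Johnson graph -/

section Johnson

open scoped Matrix

variable {p k : ℕ}

/-- The neighbours of a `k`-set arise by exchanging one of its elements for one outside it. -/
lemma sum_neighborFinset_johnsonGraph {M : Type*} [AddCommMonoid M] (F : Finset (Fin p) → M)
    (s : {s : Finset (Fin p) // s.card = k}) :
    ∑ t ∈ (johnsonGraph p k).neighborFinset s, F t.1 =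
      ∑ x ∈ s.1, ∑ y ∈ s.1ᶜ, F (insert y (s.1.erase x)) := by
  obtain ⟨s, hs⟩ := s
  rw [← Finset.sum_product']
  have hcard : ∀ a ∈ s ×ˢ sᶜ, (insert a.2 (s.erase a.1)).card = k := by
    rintro ⟨x, y⟩ h
    rw [Finset.mem_product, Finset.mem_compl] at h
    rw [Finset.card_insert_of_notMem fun hy => h.2 (Finset.mem_erase.1 hy).2,
      Finset.card_erase_add_one h.1, hs]
  symm
  refine Finset.sum_bij (fun a ha => ⟨insert a.2 (s.erase a.1), hcard a ha⟩) ?_ ?_ ?_ ?_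
  · rintro ⟨x, y⟩ h
    rw [Finset.mem_product, Finset.mem_compl] at h
    rw [SimpleGraph.mem_neighborFinset]
    change (s ∩ insert y (s.erase x)).card + 1 = k
    rw [Finset.inter_insert_of_notMem h.2,
      Finset.inter_eq_right.2 (Finset.erase_subset _ _), Finset.card_erase_add_one h.1, hs]
  · rintro ⟨x, y⟩ h ⟨x', y'⟩ h' heq
    rw [Finset.mem_product, Finset.mem_compl] at h h'
    -- comparing the two sets at `x` and at `y` forces `x = x'` and `y = y'`
    have h1 : insert y (s.erase x) = insert y' (s.erase x') := congrArg Subtype.val heq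
    have hx := Finset.ext_iff.1 h1 x
    have hy := Finset.ext_iff.1 h1 y
    simp only [Finset.mem_insert, Finset.mem_erase] at hx hy h h'
    grind
  · rintro ⟨t, ht⟩ h
    rw [SimpleGraph.mem_neighborFinset] at h
    change (s ∩ t).card + 1 = k at h
    have h1 : (s \ t).card = 1 := by
      have := Finset.card_sdiff_add_card_inter s t
      omega
    have h2 : (t \ s).card = 1 := by
      have := Finset.card_sdiff_add_card_inter t s
      rw [Finset.inter_comm] at this
      omega
    obtain ⟨x, hx⟩ := Finset.card_eq_one.1 h1
    obtain ⟨y, hy⟩ := Finset.card_eq_one.1 h2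
    have hx' : ∀ z, z ∈ s \ t ↔ z = x := fun z => by rw [hx, Finset.mem_singleton]
    have hy' : ∀ z, z ∈ t \ s ↔ z = y := fun z => by rw [hy, Finset.mem_singleton]
    simp only [Finset.mem_sdiff] at hx' hy'
    refine ⟨(x, y), ?_, Subtype.ext ?_⟩
    · rw [Finset.mem_product, Finset.mem_compl]
      exact ⟨((hx' x).2 rfl).1, ((hy' y).2 rfl).2⟩
    · ext z
      simp only [Finset.mem_insert, Finset.mem_erase]
      grind
  · intro _ _
    rfl

lemma isRegularOfDegree_johnsonGraph : (johnsonGraph p k).IsRegularOfDegree (k * (p - k)) := by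
  intro s
  rw [← SimpleGraph.card_neighborFinset_eq_degree, Finset.card_eq_sum_ones,
    sum_neighborFinset_johnsonGraph fun _ => 1]
  simp [Finset.card_compl, s.2]

lemma two_mul_card_edgeFinset_johnsonGraph :
    2 * (johnsonGraph p k).edgeFinset.card = p.choose k * (k * (p - k)) := by
  rw [← SimpleGraph.sum_degrees_eq_twice_card_edges]
  simp only [isRegularOfDegree_johnsonGraph.degree_eq, Finset.sum_const, Finset.card_univ,
    Fintype.card_finset_len, Fintype.card_fin, smul_eq_mul]

/-- The bound of `exchangeSum_eigenvalue_le` for the adjacency matrix of `J(p, k)`. -/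
lemma johnsonGraph_eigenvalue_le (hk : 1 ≤ k) (hp : k ≤ p) (μ : ℝ)
    (x : {s : Finset (Fin p) // s.card = k} → ℝ)
    (hx : (johnsonGraph p k).adjMatrix ℝ *ᵥ x = μ • x) (hsum : ∑ s, x s = 0) (hne : x ≠ 0) :
    μ ≤ (k - 1) * ((p : ℝ) - k - 1) - 1 := by
  obtain ⟨k, rfl⟩ := Nat.exists_eq_add_of_le' hk
  -- extension by zero to all finite sets, so that the bound for `exchangeSum` applies
  let f : Finset (Fin p) → ℝ := fun s => if h : s.card = k + 1 then x ⟨s, h⟩ else 0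
  have hf : ∀ s : {s : Finset (Fin p) // s.card = k + 1}, f s.1 = x s := fun s => dif_pos s.2
  have h := exchangeSum_eigenvalue_le (α := Fin p) k (by simpa using hp) f μ
    (fun s hs => by
      have h1 := congrFun hx ⟨s, hs⟩
      rw [SimpleGraph.adjMatrix_mulVec_apply, Pi.smul_apply, smul_eq_mul] at h1
      rw [exchangeSum, ← sum_neighborFinset_johnsonGraph f ⟨s, hs⟩, hf ⟨s, hs⟩, ← h1]
      exact Finset.sum_congr rfl fun t _ => hf t)
    (by
      rw [Finset.sum_subtype _ (p := fun s => s.card = k + 1)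
        (fun s => by simp [Finset.mem_powersetCard]), ← hsum]
      exact Finset.sum_congr rfl fun t _ => hf t)
    (by
      obtain ⟨s, hs⟩ := Function.ne_iff.1 hne
      exact ⟨s.1, s.2, by rw [hf]; exact hs⟩)
  rw [Fintype.card_fin] at h
  push_cast
  linarith

end Johnson

theorem mainTheorem2 (p k : ℕ) (hk : 2 ≤ k) (hp : 2 * k ≤ p) :
    (johnsonGraph p k).cliqueNum = p - k + 1 ∧
    sumSqLargestEigenvalues (johnsonGraph p k)
        (min (numPosEigenvalues (johnsonGraph p k)) (johnsonGraph p k).cliqueNum) ≤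
      2 * ((johnsonGraph p k).edgeFinset.card : ℝ) *
        (((johnsonGraph p k).cliqueNum : ℝ) - 1) / ((johnsonGraph p k).cliqueNum : ℝ) := by
  have hω := cliqueNum_johnsonGraph (by omega : 1 ≤ k) hp
  refine ⟨hω, ?_⟩
  obtain ⟨q, rfl⟩ := Nat.exists_eq_add_of_le' (by omega : k ≤ p)
  have hqk : q + k - k = q := Nat.add_sub_cancel _ _
  have hm : 2 * ((johnsonGraph (q + k) k).edgeFinset.card : ℝ) =
      (q + k).choose k * (k * q) := by
    have := two_mul_card_edgeFinset_johnsonGraph (p := q + k) (k := k)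
    rw [hqk] at this
    exact_mod_cast this
  have hk2 : (2 : ℝ) ≤ k := by exact_mod_cast hk
  have hq2 : (2 : ℝ) ≤ q := by exact_mod_cast (by omega : 2 ≤ q)
  -- with `p = q + k`, the value `c` is the bound `(k - 1) (p - k - 1) - 1` on zero-sum vectors
  have hbound := sumSqLargestEigenvalues_le (G := johnsonGraph (q + k) k) (d := k * q)
    (c := k * q - k - q) (by simpa [hqk] using isRegularOfDegree_johnsonGraph (p := q + k) (k := k))
    (by nlinarith) (by push_cast; linarith)
    (fun μ x hx hsum hne => by
      have := johnsonGraph_eigenvalue_le (by omega) (by omega) μ x hx hsum hne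
      push_cast at this
      linarith) q
  have hnum := mul_le_mul_of_nonneg_left (two_eigenvalue_sq_le q k hk (by omega))
    (by linarith : (0 : ℝ) ≤ q)
  rw [hω, hqk, hm]
  refine hbound.trans ?_
  push_cast
  rw [le_div_iff₀ (by linarith)]
  linarith
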